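/- All graphs are finite and simple. A \emph{cover} of a graph $G$ is a pair $(L,H)$, where $L$ assigns pairwise disjoint sets $L(v)$ to the vertices $v$ of $G$ and $H$ is a graph with vertex set $\bigcup_{v\in V(G)}L(v)$ such that: (i) for each $v\in V(G)$, $H[L(v)]$ is a complete graph; (ii) for each $uv\in E(G)$, the edges of $H$ between $L(u)$ and $L(v)$ form a (possibly empty) matching; (iii) for distinct $u,v\in V(G)$ with $uv\notin E(G)$, no edges of $H$ connect $L(u)$ and $L(v)$. The graph $G$ is \emph{$(L,H)$-colorable} if $H$ has an independent set of size $|V(G)|$. The \emph{DP-chromatic number} $\chi_{DP}(G)$ is the minimum $k$ such that $G$ is $(L,H)$-colorable for every cover $(L,H)$ of $G$ with $|L(v)|\ge k$ for all $v\in V(G)$. The graph $G$ is \emph{DP-$k$-critical} if $\chi_{DP}(G)=k$ and $\chi_{DP}(G')<k$ for every proper subgraph $G'$ of $G$. Let $k\ge 4$ and let $G$ be an $n$-vertex DP-$k$-critical graph that is not isomorphic to $K_k$. Then $$2|E(G)|\ \ge\ \left(k-1+\frac{k-3}{k^2-3}\right)n .$$ -/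

import Mathlib

universe u

namespace SimpleGraph

/-- A cover `(L, H)` of a graph `G`: the lists `L v` are pairwise disjoint sets, and `H` is a graph
with vertex set `⋃ v, L v` (here: the whole type `C` of colors). Each `L v` is a clique in `H`; for
adjacent `u`, `v` the edges of `H` between `L u` and `L v` form a (possibly empty) matching; for
distinct nonadjacent `u`, `v` there are no edges of `H` between `L u` and `L v`. -/
structure DPCover {V : Type u} (G : SimpleGraph V) (C : Type u) where
  /-- the lists -/
  L : V → Set C
  /-- the graph on the colors -/
  H : SimpleGraph C
  disjoint : ∀ u v : V, u ≠ v → Disjoint (L u) (L v)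
  iUnion_eq : (⋃ v, L v) = Set.univ
  isClique : ∀ v : V, H.IsClique (L v)
  /-- Every color of `L u` has at most one neighbor in `L v`; as adjacency is symmetric, this also
  holds with `u` and `v` exchanged. -/
  matching : ∀ u v : V, G.Adj u v → ∀ a ∈ L u, (H.neighborSet a ∩ L v).Subsingleton
  not_adj : ∀ u v : V, u ≠ v → ¬ G.Adj u v → ∀ a ∈ L u, ∀ b ∈ L v, ¬ H.Adj a b

/-- An `(L, H)`-coloring of a (finite) graph `G` is an independent set of `H` of size `|V(G)|`. -/
def DPCover.IsColoring {V : Type u} {G : SimpleGraph V} {C : Type u} (K : G.DPCover C)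
    (I : Set C) : Prop :=
  K.H.IsIndepSet I ∧ I.encard = ENat.card V

/-- `G` is `(L, H)`-colorable for every cover `(L, H)` with `|L v| ≥ k` for all `v`. -/
def DPColorable {V : Type u} (G : SimpleGraph V) (k : ℕ) : Prop :=
  ∀ (C : Type u) (K : G.DPCover C), (∀ v, (k : ℕ∞) ≤ (K.L v).encard) → ∃ I, K.IsColoring I

/-- The DP-chromatic number: the least `k` such that `G` is colorable from every cover with lists of
size at least `k` (and `⊤` if there is none). -/
noncomputable def dpChromaticNumber {V : Type u} (G : SimpleGraph V) : ℕ∞ :=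
  ⨅ k ∈ {k : ℕ | G.DPColorable k}, (k : ℕ∞)

/-- `G` is DP-`k`-critical: its DP-chromatic number is `k`, and every proper subgraph has a smaller
DP-chromatic number. -/
def IsDPCritical {V : Type u} (G : SimpleGraph V) (k : ℕ) : Prop :=
  G.dpChromaticNumber = k ∧ ∀ G' : G.Subgraph, G' ≠ ⊤ → G'.coe.dpChromaticNumber < k

end SimpleGraph

open Finset

namespace SimpleGraph

/-! ### Coloring from lists at least as large as the degrees -/

section ListCover

variable {V C : Type*} (G : SimpleGraph V)

/-- The number of neighbors of `v` in `U`. -/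
def degIn [DecidableRel G.Adj] (U : Finset V) (v : V) : ℕ := #{u ∈ U | G.Adj v u}

/-- The subgraph induced on `A` is connected (or empty), phrased by cuts. -/
def ConnOn [DecidableEq V] (A : Finset V) : Prop :=
  ∀ W ⊆ A, W.Nonempty → (A \ W).Nonempty → ∃ u ∈ W, ∃ v ∈ A \ W, G.Adj u v

/-- The finite lists `L v` with the conflict graph `H` satisfy the matching conditions of a cover
of `G`. -/
structure IsListCover (L : V → Finset C) (H : SimpleGraph C) : Prop where
  matching : ∀ u v, G.Adj u v → ∀ a ∈ L u, ∀ b ∈ L v, ∀ b' ∈ L v, H.Adj a b → H.Adj a b' → b = b'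
  not_adj : ∀ u v, u ≠ v → ¬ G.Adj u v → ∀ a ∈ L u, ∀ b ∈ L v, ¬ H.Adj a b

/-- `f` chooses conflict-free colors from the lists on `U`. -/
def ColorsOn (L : V → Finset C) (H : SimpleGraph C) (U : Finset V) (f : V → C) : Prop :=
  (∀ v ∈ U, f v ∈ L v) ∧ ∀ u ∈ U, ∀ v ∈ U, ¬ H.Adj (f u) (f v)

open Classical in
/-- The colors not in conflict with the coloring `f` of `P`. -/
noncomputable def residual (L : V → Finset C) (H : SimpleGraph C) (P : Finset V) (f : V → C)
    (v : V) : Finset C :=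
  {c ∈ L v | ∀ u ∈ P, ¬ H.Adj (f u) c}

variable {G} {L : V → Finset C} {H : SimpleGraph C}

lemma mem_residual {P : Finset V} {f : V → C} {v : V} {c : C} :
    c ∈ residual L H P f v ↔ c ∈ L v ∧ ∀ u ∈ P, ¬ H.Adj (f u) c := by
  simp [residual]

lemma residual_subset (P : Finset V) (f : V → C) (v : V) : residual L H P f v ⊆ L v :=
  fun _ h => (mem_residual.1 h).1

lemma IsListCover.mono (hL : G.IsListCover L H) {L' : V → Finset C} (h : ∀ v, L' v ⊆ L v) :
    G.IsListCover L' H where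
  matching u v huv a ha b hb b' hb' := hL.matching u v huv a (h _ ha) b (h _ hb) b' (h _ hb')
  not_adj u v hne huv a ha b hb := hL.not_adj u v hne huv a (h _ ha) b (h _ hb)

lemma ColorsOn.mono {U W : Finset V} {f : V → C} (h : ColorsOn L H W f) (hU : U ⊆ W) :
    ColorsOn L H U f :=
  ⟨fun v hv => h.1 v (hU hv), fun u hu v hv => h.2 u (hU hu) v (hU hv)⟩

variable [DecidableRel G.Adj]

lemma degIn_mono {U W : Finset V} (h : U ⊆ W) (v : V) : G.degIn U v ≤ G.degIn W v :=
  card_le_card (filter_subset_filter _ h)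

lemma degIn_lt {U W : Finset V} (h : U ⊆ W) {v w : V} (hw : w ∈ W) (hwU : w ∉ U)
    (hvw : G.Adj v w) : G.degIn U v < G.degIn W v := by
  refine card_lt_card ((ssubset_iff_of_subset (filter_subset_filter _ h)).2 ⟨w, ?_, ?_⟩)
  · simp [hw, hvw]
  · simp [hwU]

lemma degIn_singleton (u v : V) : G.degIn {u} v = if G.Adj v u then 1 else 0 := by
  unfold degIn
  rw [filter_singleton]
  split_ifs <;> simp

/-- By the matching condition each colored neighbor of `v` forbids at most one color of `L v`, and
non-neighbors forbid none. -/
lemma IsListCover.card_le_residual (hL : G.IsListCover L H) {P : Finset V} {f : V → C}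
    (hf : ∀ u ∈ P, f u ∈ L u) {v : V} (hv : v ∉ P) :
    #(L v) ≤ #(residual L H P f v) + G.degIn P v := by
  classical
  have hsub : L v ⊆ residual L H P f v ∪
      ({u ∈ P | G.Adj v u}).biUnion fun u => {c ∈ L v | H.Adj (f u) c} := by
    intro c hc
    by_cases h : ∀ u ∈ P, ¬ H.Adj (f u) c
    · exact mem_union_left _ (mem_residual.2 ⟨hc, h⟩)
    · push Not at h
      obtain ⟨u, hu, huc⟩ := h
      have huv : G.Adj u v := by
        by_contra hn
        exact hL.not_adj u v (fun h => hv (h ▸ hu)) hn _ (hf u hu) _ hc huc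
      exact mem_union_right _ (mem_biUnion.2
        ⟨u, mem_filter.2 ⟨hu, huv.symm⟩, mem_filter.2 ⟨hc, huc⟩⟩)
  refine (card_le_card hsub).trans ((card_union_le _ _).trans (Nat.add_le_add_left ?_ _))
  refine (card_biUnion_le_card_mul _ _ 1 fun u hu => ?_).trans (by simp [degIn])
  obtain ⟨hu, hvu⟩ := mem_filter.1 hu
  refine card_le_one.2 fun b hb b' hb' => ?_
  simp only [mem_filter] at hb hb'
  exact hL.matching u v hvu.symm _ (hf u hu) b hb.1 b' hb'.1 hb.2 hb'.2

variable [DecidableEq V]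

lemma degIn_union {U W : Finset V} (h : Disjoint U W) (v : V) :
    G.degIn (U ∪ W) v = G.degIn U v + G.degIn W v := by
  unfold degIn
  rw [filter_union, card_union_of_disjoint (disjoint_filter_filter h)]

lemma degIn_sdiff {U W : Finset V} (h : U ⊆ W) (v : V) :
    G.degIn W v = G.degIn U v + G.degIn (W \ U) v := by
  rw [← degIn_union disjoint_sdiff, union_sdiff_of_subset h]

/-- A coloring of `P` and a coloring of `U` from the residual lists fit together. -/
lemma ColorsOn.union {P U : Finset V} (hd : Disjoint P U) {f g : V → C}
    (hf : ColorsOn L H P f) (hg : ColorsOn (residual L H P f) H U g) :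
    ColorsOn L H (P ∪ U) (fun v => if v ∈ P then f v else g v) := by
  have hres : ∀ v ∈ U, ∀ u ∈ P, ¬ H.Adj (f u) (g v) := fun v hv =>
    (mem_residual.1 (hg.1 v hv)).2
  have hnot : ∀ v ∈ U, v ∉ P := fun v hv hP => Finset.disjoint_left.1 hd hP hv
  refine ⟨fun v hv => ?_, fun u hu v hv => ?_⟩
  · by_cases hP : v ∈ P
    · simpa [hP] using hf.1 v hP
    · simpa [hP] using residual_subset _ _ _ (hg.1 v ((mem_union.1 hv).resolve_left hP))
  · rcases mem_union.1 hu with hu | hu <;> rcases mem_union.1 hv with hv | hv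
    · simpa [hu, hv] using hf.2 u hu v hv
    · simpa [hu, hnot v hv] using hres v hv u hu
    · simpa [hv, hnot u hu] using fun h => hres u hu v hv (H.adj_symm h)
    · simpa [hnot u hu, hnot v hv] using hg.2 u hu v hv

/-- Greedy coloring. -/
lemma IsListCover.exists_colorsOn_of_degenerate [Nonempty C] (hL : G.IsListCover L H)
    (U : Finset V) (h : ∀ W ⊆ U, W.Nonempty → ∃ v ∈ W, G.degIn W v < #(L v)) :
    ∃ f, ColorsOn L H U f := by
  induction U using Finset.strongInduction with
  | H U ih =>
    rcases U.eq_empty_or_nonempty with rfl | hU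
    · exact ⟨fun _ => Classical.arbitrary C, by simp [ColorsOn]⟩
    obtain ⟨v, hvU, hv⟩ := h U Subset.rfl hU
    obtain ⟨f, hf⟩ := ih (U.erase v) (erase_ssubset hvU) fun W hW =>
      h W (hW.trans (erase_subset _ _))
    have h1 := hL.card_le_residual hf.1 (notMem_erase v U)
    have h2 := degIn_mono (G := G) (erase_subset v U) v
    obtain ⟨c, hc⟩ : (residual L H (U.erase v) f v).Nonempty := card_pos.1 (by omega)
    have := hf.union (U := {v}) (by simp) (g := fun _ => c)
      ⟨by simpa using hc, by simp⟩
    refine ⟨_, this.mono ?_⟩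
    rw [union_comm, ← insert_eq, insert_erase hvU]

/-- A connected set with lists as large as the degrees, and larger at one vertex, is colorable. -/
lemma IsListCover.exists_colorsOn_of_slack (hL : G.IsListCover L H) {A : Finset V}
    (hA : G.ConnOn A) (hdeg : ∀ v ∈ A, G.degIn A v ≤ #(L v)) {x : V} (hx : x ∈ A)
    (hlt : G.degIn A x < #(L x)) : ∃ f, ColorsOn L H A f := by
  have : Nonempty C := ⟨(card_pos.1 (by omega : 0 < #(L x))).choose⟩
  refine hL.exists_colorsOn_of_degenerate A fun W hW hne => ?_
  rcases (A \ W).eq_empty_or_nonempty with h | h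
  · obtain rfl : W = A := hW.antisymm (sdiff_eq_empty_iff_subset.1 h)
    exact ⟨x, hx, hlt⟩
  -- An edge leaving `W` supplies the slack at its end in `W`; only `W = A` needs `x`.
  · obtain ⟨u, hu, v, hv, huv⟩ := hA W hW hne h
    rw [mem_sdiff] at hv
    exact ⟨u, hu, (degIn_lt hW hv.1 hv.2 huv).trans_le (hdeg u (hW hu))⟩

/-- A coloring of `P ⊆ B` extends to `B` if `B \ P` is connected and its residual lists leave some
slack. -/
lemma ColorsOn.extend_of_slack (hL : G.IsListCover L H) {P B : Finset V} (hPB : P ⊆ B) {f : V → C}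
    (hf : ColorsOn L H P f) (hconn : G.ConnOn (B \ P)) (hdeg : ∀ v ∈ B, G.degIn B v ≤ #(L v))
    {x : V} (hx : x ∈ B \ P) (hlt : G.degIn (B \ P) x < #(residual L H P f x)) :
    ∃ g, ColorsOn L H B g := by
  obtain ⟨g, hg⟩ := (hL.mono (residual_subset P f)).exists_colorsOn_of_slack hconn
    (fun v hv => by
      rw [mem_sdiff] at hv
      have h1 := hL.card_le_residual hf.1 hv.2
      have h2 := hdeg v hv.1
      rw [degIn_sdiff hPB] at h2
      omega) hx hlt
  have := hf.union disjoint_sdiff hg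
  rw [union_sdiff_of_subset hPB] at this
  exact ⟨_, this⟩

lemma card_list_eq_degIn (hL : G.IsListCover L H) {B : Finset V} (hB : G.ConnOn B)
    (hdeg : ∀ v ∈ B, G.degIn B v ≤ #(L v)) (hbad : ¬ ∃ f, ColorsOn L H B f) {v : V} (hv : v ∈ B) :
    #(L v) = G.degIn B v :=
  ((hdeg v hv).eq_or_lt.resolve_right fun h =>
    hbad (hL.exists_colorsOn_of_slack hB hdeg hv h)).symm

/-- If `a` had no neighbor in `L v`, giving `u` the color `a` would lower the degree of `v` without
shrinking its list, and the slack would yield a coloring. -/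
lemma exists_conflict (hL : G.IsListCover L H) {B : Finset V} {u v : V}
    (hB : G.ConnOn (B.erase u)) (hdeg : ∀ v ∈ B, G.degIn B v ≤ #(L v))
    (hbad : ¬ ∃ f, ColorsOn L H B f) (hu : u ∈ B) (hv : v ∈ B) (huv : G.Adj u v) {a : C}
    (ha : a ∈ L u) : ∃ b ∈ L v, H.Adj a b := by
  by_contra! hcon
  have hsub : ({u} : Finset V) ⊆ B := by simpa using hu
  refine hbad (ColorsOn.extend_of_slack hL hsub (f := fun _ => a)
    ⟨by simpa using ha, by simp⟩ (by rwa [sdiff_singleton_eq_erase]) hdeg (x := v) ?_ ?_)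
  · simp [hv, huv.ne']
  · have h1 := hdeg v hv
    rw [degIn_sdiff hsub, degIn_singleton, if_pos huv.symm] at h1
    have : residual L H {u} (fun _ => a) v = L v := by
      ext c
      simpa [mem_residual] using hcon c
    rw [this]
    omega

/-- The conflicts between the two lists form a matching that saturates `L u`, and list sizes equal
degrees. -/
lemma degIn_le_of_adj (hL : G.IsListCover L H) {B : Finset V} (hB : G.ConnOn B)
    (hB' : ∀ u, G.ConnOn (B.erase u)) (hdeg : ∀ v ∈ B, G.degIn B v ≤ #(L v))
    (hbad : ¬ ∃ f, ColorsOn L H B f) {u v : V} (hu : u ∈ B) (hv : v ∈ B) (huv : G.Adj u v) :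
    G.degIn B u ≤ G.degIn B v := by
  rw [← card_list_eq_degIn hL hB hdeg hbad hu, ← card_list_eq_degIn hL hB hdeg hbad hv]
  have h := fun a (ha : a ∈ L u) => exists_conflict hL (hB' u) hdeg hbad hu hv huv ha
  choose! m hm using h
  refine card_le_card_of_injOn m (fun a ha => (hm a ha).1) fun a ha a' ha' h => ?_
  exact hL.matching v u huv.symm _ (hm a ha).1 a ha a' ha' (hm a ha).2.symm
    (h ▸ (hm a' ha').2.symm)

/-- A set without cut vertices which is not colorable from lists as large as the degrees induces
a regular subgraph. -/
lemma degIn_eq_of_bad (hL : G.IsListCover L H) {B : Finset V} (hB : G.ConnOn B)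
    (hB' : ∀ u, G.ConnOn (B.erase u)) (hdeg : ∀ v ∈ B, G.degIn B v ≤ #(L v))
    (hbad : ¬ ∃ f, ColorsOn L H B f) {x v : V} (hx : x ∈ B) (hv : v ∈ B) :
    G.degIn B v = G.degIn B x := by
  by_contra hne
  obtain ⟨u, hu, w, hw, huw⟩ := hB {w ∈ B | G.degIn B w = G.degIn B x} (filter_subset _ _)
    ⟨x, by simp [hx]⟩ ⟨v, by simp [hv, hne]⟩
  simp only [mem_sdiff, mem_filter, not_and] at hu hw
  have h1 := degIn_le_of_adj hL hB hB' hdeg hbad hu.1 hw.1 huw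
  have h2 := degIn_le_of_adj hL hB hB' hdeg hbad hw.1 hu.1 huw.symm
  exact hw.2 hw.1 (by omega)

end ListCover

/-! ### Lovász's lemma and Brooks's theorem for covers -/

section Brooks

variable {V C : Type*} [DecidableEq V] {G : SimpleGraph V} {L : V → Finset C} {H : SimpleGraph C}

lemma ConnOn.insert {A : Finset V} (hA : G.ConnOn A) {x y : V} (hy : y ∈ A) (hxy : G.Adj x y) :
    G.ConnOn (insert x A) := by
  intro W hW hne hne'
  by_cases hxA : x ∈ A
  · rw [insert_eq_of_mem hxA] at *
    exact hA W hW hne hne'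
  by_cases h1 : (W ∩ A).Nonempty
  · by_cases h2 : (A \ W).Nonempty
    · obtain ⟨u, hu, v, hv, huv⟩ := hA (W ∩ A) inter_subset_right h1 (by
        rwa [inter_comm, sdiff_inter_self_left])
      simp only [mem_sdiff, mem_inter] at hu hv
      exact ⟨u, hu.1, v, by simp only [mem_sdiff, mem_insert]; tauto, huv⟩
    · have hAW : A ⊆ W := by simpa [sdiff_eq_empty_iff_subset] using h2
      obtain ⟨v, hv⟩ := hne'
      simp only [mem_sdiff, mem_insert] at hv
      obtain rfl : v = x := hv.1.resolve_right fun h => hv.2 (hAW h)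
      exact ⟨y, hAW hy, v, by simp [hv.2], hxy.symm⟩
  · obtain ⟨w, hw⟩ := hne
    have hn : ∀ v ∈ A, v ∉ W := fun v hv hvW => h1 ⟨v, mem_inter.2 ⟨hvW, hv⟩⟩
    obtain rfl : w = x := (mem_insert.1 (hW hw)).resolve_right fun h => hn w h hw
    exact ⟨w, hw, y, by simp [hy, hn y hy], hxy⟩

/-- `S` is attached to the rest of `A` through the vertex `w` only. -/
def IsPendant (G : SimpleGraph V) (A S : Finset V) (w : V) : Prop :=
  S ⊆ A ∧ S.Nonempty ∧ w ∈ A \ S ∧ ∀ u ∈ S, ∀ v ∈ A, G.Adj u v → v ∈ S ∨ v = w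

lemma IsPendant.exists_minimal {A S : Finset V} {w : V} (h : IsPendant G A S w) :
    ∃ T ⊆ S, ∃ w', IsPendant G A T w' ∧ ∀ T' ⊂ T, ∀ w'', ¬ IsPendant G A T' w'' := by
  induction S using Finset.strongInduction generalizing w with
  | H S ih =>
    by_cases hm : ∀ T' ⊂ S, ∀ w'', ¬ IsPendant G A T' w''
    · exact ⟨S, Subset.rfl, w, h, hm⟩
    · push Not at hm
      obtain ⟨T', hT', w'', hw⟩ := hm
      obtain ⟨T, hT, r⟩ := ih T' hT' hw
      exact ⟨T, hT.trans hT'.subset, r⟩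

/-- Removing a vertex of a minimal pendant set, and one vertex elsewhere, does not separate the
neighbors of the former. -/
lemma IsPendant.mem_iff {A S : Finset V} {w y y' : V} (h : IsPendant G A S w)
    (hmin : ∀ T' ⊂ S, ∀ w'', ¬ IsPendant G A T' w'') (hy : y ∈ S) (hy' : y' ∉ S) (hwy' : w ≠ y')
    {W : Finset V} (hW : W ⊆ A \ {y, y'})
    (hsep : ∀ u ∈ W, ∀ v ∈ (A \ {y, y'}) \ W, ¬ G.Adj u v) {v : V} (hv : v ∈ A \ {y, y'})
    (hyv : G.Adj y v) : v ∈ W ↔ w ∈ W := by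
  obtain ⟨hSA, -, hw, hS⟩ := h
  rw [mem_sdiff] at hw
  have hwy : w ≠ y := fun h => hw.2 (h ▸ hy)
  -- A side `X` avoiding `w` but meeting `S` would make `X ∩ S` a smaller pendant set, attached at
  -- `y`.
  have key : ∀ X ⊆ A \ {y, y'}, (∀ u ∈ X, ∀ v ∈ (A \ {y, y'}) \ X, ¬ G.Adj u v) → w ∉ X →
      ∀ v ∈ S, v ∉ X := by
    intro X hX hXsep hwX v hvS hvX
    refine hmin (X ∩ S) ⟨inter_subset_right, fun hsub => ?_⟩ y
      ⟨inter_subset_right.trans hSA, ⟨v, mem_inter.2 ⟨hvX, hvS⟩⟩, ?_, ?_⟩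
    · have := hX (mem_inter.1 (hsub hy)).1
      simp at this
    · have : y ∉ X := fun h => by simpa using hX h
      simp [hSA hy, this]
    · intro u hu t ht hut
      rw [mem_inter] at hu ⊢
      by_contra! hcon
      have hsep' := hXsep u hu.1 t
      simp only [mem_sdiff, mem_insert, mem_singleton] at hsep'
      rcases hS u hu.2 t ht hut with h | rfl
      · exact hsep' ⟨⟨ht, by rintro (h' | rfl) <;> [exact hcon.2 h'; exact hy' h]⟩,
          fun hh => hcon.1 hh h⟩ hut
      · exact hsep' ⟨⟨ht, by rintro (h' | h') <;> [exact hcon.2 h'; exact hwy' h']⟩, hwX⟩ hut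
  have hwA : w ∈ A \ {y, y'} := by simp [hw.1, hwy, hwy']
  rcases hS y hy v (mem_sdiff.1 hv).1 hyv with hvS | rfl
  · by_cases hwW : w ∈ W
    · have h1 := key ((A \ {y, y'}) \ W) sdiff_subset (fun u hu t ht hut => by
        rw [mem_sdiff] at hu
        rw [Finset.sdiff_sdiff_eq_self hW] at ht
        exact hsep t ht u (mem_sdiff.2 hu) hut.symm) (by simp [hwW]) v hvS
      rw [mem_sdiff, not_and_not_right] at h1
      simp [hwW, h1 hv]
    · simp [hwW, key W hW hsep hwW v hvS]
  · rfl

/-- Otherwise `w` would be a cut vertex of `B`, separating `S` from `x`. -/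
lemma IsPendant.exists_adj {B S : Finset V} {x w : V} (hx : x ∈ B)
    (hB' : ∀ y, G.ConnOn (B.erase y)) (h : IsPendant G (B.erase x) S w) :
    ∃ y ∈ S, G.Adj x y := by
  obtain ⟨hSA, hne, hw, hS⟩ := h
  rw [mem_sdiff, mem_erase] at hw
  have hxS : x ∉ S := fun h => by simpa using hSA h
  obtain ⟨u, hu, v, hv, huv⟩ := hB' w S
    (fun t ht => mem_erase.2 ⟨fun h => hw.2 (h ▸ ht), mem_of_mem_erase (hSA ht)⟩) hne
    ⟨x, by simp [hxS, hx, hw.1.1.symm]⟩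
  simp only [mem_sdiff, mem_erase] at hv
  by_cases hvx : v = x
  · exact ⟨u, hu, hvx ▸ huv.symm⟩
  · rcases hS u hu v (mem_erase.2 ⟨hvx, hv.1.2⟩) huv with h | h
    · exact absurd h hv.2
    · exact absurd h hv.1.1

lemma IsPendant.exists_adj_attach {A S : Finset V} {w : V} (hA : G.ConnOn A)
    (h : IsPendant G A S w) : ∃ u ∈ S, G.Adj u w := by
  obtain ⟨hSA, hne, hw, hS⟩ := h
  obtain ⟨u, hu, v, hv, huv⟩ := hA S hSA hne ⟨w, hw⟩
  rw [mem_sdiff] at hv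
  exact ⟨u, hu, (hS u hu v hv.1 huv).resolve_left hv.2 ▸ huv⟩

variable [DecidableRel G.Adj]

/-- Lovász's lemma: a noncomplete graph without cut vertices and of minimum degree at least `3`
has two nonadjacent vertices with a common neighbor whose removal does not disconnect it. -/
lemma exists_connOn_sdiff_pair {B : Finset V} (hB : G.ConnOn B)
    (hB' : ∀ y, G.ConnOn (B.erase y)) (h3 : ∀ x ∈ B, 3 ≤ G.degIn B x) {a b : V} (ha : a ∈ B)
    (hb : b ∈ B) (hab : a ≠ b) (hnab : ¬ G.Adj a b) :
    ∃ x ∈ B, ∃ y ∈ B, ∃ z ∈ B, G.Adj x y ∧ G.Adj x z ∧ y ≠ z ∧ ¬ G.Adj y z ∧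
      G.ConnOn (B \ {y, z}) := by
  by_cases h : ∀ x ∈ B, ∀ z ∈ B, x ≠ z → G.ConnOn (B \ {x, z})
  -- If no pair separates, any two vertices at distance two serve; here `a` and `v`, with common
  -- neighbor `u`.
  · obtain ⟨u, hu, v, hv, huv⟩ := hB {u ∈ B | u = a ∨ G.Adj a u} (filter_subset _ _)
      ⟨a, by simp [ha]⟩ ⟨b, by simp [hb, hab.symm, hnab]⟩
    simp only [mem_sdiff, mem_filter, not_and, not_or] at hu hv
    obtain ⟨hv1, hv2⟩ := hv
    have hv2 := hv2 hv1
    have hau : G.Adj a u := hu.2.resolve_left (by rintro rfl; exact hv2.2 huv)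
    exact ⟨u, hu.1, a, ha, v, hv1, hau.symm, huv, Ne.symm hv2.1, hv2.2,
      h a ha v hv1 (Ne.symm hv2.1)⟩
  push Not at h
  obtain ⟨x, hx, z, hz, hxz, hdis⟩ := h
  unfold ConnOn at hdis
  push Not at hdis
  obtain ⟨W, hW, hne, hne', hsep⟩ := hdis
  set W' := (B \ {x, z}) \ W with hW'
  have hzA : z ∈ B.erase x := mem_erase.2 ⟨hxz.symm, hz⟩
  have hmem : ∀ v ∈ B.erase x, v ∈ W ∨ v ∈ W' ∨ v = z := by
    intro v hv
    simp only [hW', mem_sdiff, mem_insert, mem_singleton]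
    have := mem_erase.1 hv
    tauto
  have hWA : ∀ v ∈ W, v ∈ B.erase x ∧ v ≠ z ∧ v ∉ W' := fun v hv => by
    have := hW hv
    simp only [mem_sdiff, mem_insert, mem_singleton, mem_erase, hW'] at this ⊢
    tauto
  have hWA' : ∀ v ∈ W', v ∈ B.erase x ∧ v ≠ z ∧ v ∉ W := fun v hv => by
    simp only [mem_sdiff, mem_insert, mem_singleton, mem_erase, hW'] at hv ⊢
    tauto
  have hpW : IsPendant G (B.erase x) W z := ⟨fun v hv => (hWA v hv).1, hne,
    mem_sdiff.2 ⟨hzA, fun h => (hWA z h).2.1 rfl⟩, fun u hu v hv huv => by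
      rcases hmem v hv with h | h | h
      · exact Or.inl h
      · exact absurd huv (hsep u hu v h)
      · exact Or.inr h⟩
  have hpW' : IsPendant G (B.erase x) W' z := ⟨fun v hv => (hWA' v hv).1, hne',
    mem_sdiff.2 ⟨hzA, fun h => (hWA' z h).2.1 rfl⟩, fun u hu v hv huv => by
      rcases hmem v hv with h | h | h
      · exact absurd huv.symm (hsep v h u hu)
      · exact Or.inl h
      · exact Or.inr h⟩
  -- Now `z` is a cut vertex of `B.erase x`. The pair consists of neighbors of `x` in minimal
  -- pendant sets on the two sides of `z`.
  obtain ⟨S, hSW, s, hS, hSmin⟩ := hpW.exists_minimal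
  obtain ⟨T, hTW, t, hT, hTmin⟩ := hpW'.exists_minimal
  obtain ⟨y, hyS, hxy⟩ := hS.exists_adj hx hB'
  obtain ⟨y', hyT, hxy'⟩ := hT.exists_adj hx hB'
  have hA := hB' x
  have hyA := hS.1 hyS
  have hyA' := hT.1 hyT
  have hyT' : y ∉ T := fun h => (hWA y (hSW hyS)).2.2 (hTW h)
  have hyS' : y' ∉ S := fun h => (hWA y' (hSW h)).2.2 (hTW hyT)
  have hyy : y ≠ y' := fun h => hyT' (h ▸ hyT)
  have hnadj : ¬ G.Adj y y' := hsep y (hSW hyS) y' (hTW hyT)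
  have hsy' : s ≠ y' := by
    rintro rfl
    obtain ⟨u, hu, hus⟩ := hS.exists_adj_attach hA
    exact hsep u (hSW hu) s (hTW hyT) hus
  have hty : t ≠ y := by
    rintro rfl
    obtain ⟨u, hu, hut⟩ := hT.exists_adj_attach hA
    exact hsep t (hSW hyS) u (hTW hu) hut.symm
  refine ⟨x, hx, y, mem_of_mem_erase hyA, y', mem_of_mem_erase hyA', hxy, hxy', hyy, hnadj, ?_⟩
  have hconn : G.ConnOn (B.erase x \ {y, y'}) := by
    intro X hX hXne hXne'
    by_contra! hXsep
    have hy1 := fun v hv hyv => hS.mem_iff hSmin hyS hyS' hsy' hX hXsep (v := v) hv hyv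
    have hy2 : ∀ v ∈ B.erase x \ {y, y'}, G.Adj y' v → (v ∈ X ↔ t ∈ X) := fun v hv hyv =>
      hT.mem_iff hTmin hyT hyT' hty (W := X) (by rwa [pair_comm]) (by rwa [pair_comm])
        (by rwa [pair_comm]) hyv
    have hXA : ∀ v ∈ X, v ∈ B.erase x ∧ v ≠ y ∧ v ≠ y' := fun v hv => by
      simpa only [mem_sdiff, mem_insert, mem_singleton, not_or] using hX hv
    obtain ⟨r, hr⟩ := hXne'
    have hr' := hr
    simp only [mem_sdiff, mem_insert, mem_singleton, not_or] at hr'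
    -- Putting `y` on the side of `s` and `y'` on the side of `t` extends the separation to `B.erase
    -- x`, which is connected.
    obtain ⟨u, hu, v, hv, huv⟩ := hA {v ∈ B.erase x | v ∈ X ∨ v = y ∧ s ∈ X ∨ v = y' ∧ t ∈ X}
      (filter_subset _ _) (by
        obtain ⟨p, hp⟩ := hXne
        exact ⟨p, mem_filter.2 ⟨(hXA p hp).1, Or.inl hp⟩⟩)
      ⟨r, by
        rw [mem_sdiff, mem_filter]
        tauto⟩
    rw [mem_sdiff, mem_filter] at hv
    rw [mem_filter] at hu
    obtain ⟨hvA, hv⟩ := hv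
    have hv : ¬ (v ∈ X ∨ v = y ∧ s ∈ X ∨ v = y' ∧ t ∈ X) := fun h => hv ⟨hvA, h⟩
    push Not at hv
    obtain ⟨hvX, hvy, hvy'⟩ := hv
    have hcase : ∀ p ∈ B.erase x, p = y ∨ p = y' ∨ p ∈ B.erase x \ {y, y'} := by
      intro p hp
      simp only [mem_sdiff, mem_insert, mem_singleton]
      tauto
    rcases hu.2 with h | ⟨rfl, h⟩ | ⟨rfl, h⟩
    · rcases hcase v hvA with rfl | rfl | hv
      · exact hvy rfl ((hy1 u (hX h) huv.symm).1 h)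
      · exact hvy' rfl ((hy2 u (hX h) huv.symm).1 h)
      · exact hXsep u h v (mem_sdiff.2 ⟨hv, hvX⟩) huv
    · rcases hcase v hvA with rfl | rfl | hv
      · exact G.loopless.irrefl _ huv
      · exact hnadj huv
      · exact hvX ((hy1 v hv huv).2 h)
    · rcases hcase v hvA with rfl | rfl | hv
      · exact hnadj huv.symm
      · exact G.loopless.irrefl _ huv
      · exact hvX ((hy2 v hv huv).2 h)
  -- A third neighbor of `x` reattaches `x`; this is where degree at least `3` is needed.
  obtain ⟨q, hq, hqP⟩ : ∃ q ∈ ({u ∈ B | G.Adj x u} : Finset V), q ∉ ({y, y'} : Finset V) := by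
    by_contra! hcon
    have h1 := card_le_card (show ({u ∈ B | G.Adj x u} : Finset V) ⊆ {y, y'} from hcon)
    have h2 := h3 x hx
    have h3 := card_le_two (a := y) (b := y')
    unfold degIn at h2
    omega
  rw [mem_filter] at hq
  have := hconn.insert (y := q) (mem_sdiff.2 ⟨mem_erase.2 ⟨hq.2.ne', hq.1⟩, hqP⟩) hq.2
  rwa [erase_sdiff_comm, insert_erase (mem_sdiff.2 ⟨hx, by
    simp [hxy.ne, hxy'.ne]⟩)] at this

/-- Brooks's theorem for list covers. -/
theorem adj_of_bad (hL : G.IsListCover L H) {B : Finset V} (hB : G.ConnOn B)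
    (hB' : ∀ u, G.ConnOn (B.erase u)) (hdeg : ∀ v ∈ B, G.degIn B v ≤ #(L v))
    (hbad : ¬ ∃ f, ColorsOn L H B f) (h3 : ∀ x ∈ B, 3 ≤ G.degIn B x) {a b : V} (ha : a ∈ B)
    (hb : b ∈ B) (hab : a ≠ b) : G.Adj a b := by
  classical
  by_contra hnab
  obtain ⟨x, hx, y, hy, z, hz, hxy, hxz, hyz, hnyz, hconn⟩ :=
    exists_connOn_sdiff_pair hB hB' h3 ha hb hab hnab
  obtain ⟨c, hc⟩ : (L x).Nonempty := card_pos.1 (by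
    have := h3 x hx
    have := hdeg x hx
    omega)
  obtain ⟨p, hp, hcp⟩ := exists_conflict hL (hB' x) hdeg hbad hx hy hxy hc
  obtain ⟨q, hq, hcq⟩ := exists_conflict hL (hB' x) hdeg hbad hx hz hxz hc
  have hsub : ({y, z} : Finset V) ⊆ B := by simp [insert_subset_iff, hy, hz]
  have hpq : ¬ H.Adj p q := hL.not_adj y z hyz hnyz p hp q hq
  -- Both `p` and `q` conflict with the same color `c`, so `x` loses two uncolored neighbors but
  -- only one color.
  refine hbad (ColorsOn.extend_of_slack hL hsub (f := fun v => if v = y then p else q)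
    ⟨?_, ?_⟩ hconn hdeg (x := x) (by simp [hx, hxy.ne, hxz.ne]) ?_)
  · simp [hp, hq, hyz.symm]
  · simp [hyz.symm, hpq, H.adj_comm q p]
  · have h1 : (L x).erase c ⊆
        residual L H {y, z} (fun v => if v = y then p else q) x := by
      intro d hd
      rw [mem_erase] at hd
      refine mem_residual.2 ⟨hd.2, ?_⟩
      simp only [mem_insert, mem_singleton, forall_eq_or_imp, forall_eq, if_true, hyz.symm,
        if_false]
      exact ⟨fun h => hd.1 (hL.matching y x hxy.symm p hp d hd.2 c hc h hcp.symm),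
        fun h => hd.1 (hL.matching z x hxz.symm q hq d hd.2 c hc h hcq.symm)⟩
    have h2 := card_le_card h1
    rw [card_erase_of_mem hc] at h2
    have h4 := hdeg x hx
    have h5 : G.degIn {y, z} x = 2 := by
      rw [show ({y, z} : Finset V) = {y} ∪ {z} from rfl, degIn_union (by simpa using hyz),
        degIn_singleton, degIn_singleton, if_pos hxy, if_pos hxz]
    rw [degIn_sdiff hsub, h5] at h4
    omega

end Brooks

/-! ### End blocks and Gallai's edge bound -/

section Counting

variable {V : Type*} {G : SimpleGraph V} [DecidableRel G.Adj]

lemma sum_degIn_comm (A B : Finset V) : ∑ v ∈ A, G.degIn B v = ∑ v ∈ B, G.degIn A v := by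
  simp only [degIn, card_filter]
  rw [sum_comm]
  simp only [G.adj_comm]

variable [DecidableEq V]

lemma sum_degIn_self {R U : Finset V} (h : R ⊆ U) :
    ∑ v ∈ U, G.degIn U v = ∑ v ∈ U \ R, G.degIn (U \ R) v + ∑ v ∈ R, G.degIn R v +
      2 * ∑ v ∈ R, G.degIn (U \ R) v := by
  have h1 : ∑ v ∈ U \ R, G.degIn R v = ∑ v ∈ R, G.degIn (U \ R) v := sum_degIn_comm _ _
  rw [← sum_sdiff h]
  simp only [degIn_sdiff h, sum_add_distrib]
  omega

/-- Every nonempty set of vertices contains a set `B` without cut vertices that is joined to the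
rest through at most one of its vertices (an end block). -/
lemma exists_end_block {U : Finset V} (hU : U.Nonempty) :
    ∃ S B : Finset V, S.Nonempty ∧ B ⊆ U ∧ G.ConnOn B ∧ (∀ y, G.ConnOn (B.erase y)) ∧
      (∀ u ∈ S, ∀ v ∈ U, G.Adj u v → v ∈ B) ∧ (B = S ∨ ∃ x, x ∉ S ∧ B = insert x S) := by
  classical
  -- A smallest such `S` is an end block without its cut vertex. The vertex `x` may be irrelevant;
  -- it joins `B` only if it is a neighbor of `S` in `U` outside `S`.
  let Q : Finset V → Prop := fun S =>
    S.Nonempty ∧ ∃ x, ∀ u ∈ S, ∀ v ∈ U, G.Adj u v → v ∈ S ∨ v = x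
  obtain ⟨S, hS, hmin⟩ := exists_min_image (U.powerset.filter Q) card
    ⟨U, by
      simp only [Q, mem_filter, mem_powerset, Subset.rfl, true_and]
      exact ⟨hU, hU.choose, fun u _ v hv _ => Or.inl hv⟩⟩
  simp only [mem_filter, mem_powerset] at hS hmin
  obtain ⟨hSU, hne, x, hx⟩ := hS
  have hmin' : ∀ T ⊆ S, T.Nonempty → ∀ y, (∀ u ∈ T, ∀ v ∈ U, G.Adj u v → v ∈ T ∨ v = y) →
      T = S := fun T hT hT' y hy =>
    eq_of_subset_of_card_le hT (hmin T ⟨hT.trans hSU, hT', y, hy⟩)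
  obtain ⟨B, hSB, hBU, hB, hB'⟩ : ∃ B, S ⊆ B ∧ B ⊆ U ∧ (∀ u ∈ S, ∀ v ∈ U, G.Adj u v → v ∈ B) ∧
      (B = S ∨ x ∉ S ∧ B = insert x S ∧ ∃ u ∈ S, G.Adj u x) := by
    by_cases h : x ∈ U ∧ x ∉ S ∧ ∃ u ∈ S, G.Adj u x
    · refine ⟨insert x S, subset_insert _ _, insert_subset h.1 hSU, fun u hu v hv huv => ?_,
        Or.inr ⟨h.2.1, rfl, h.2.2⟩⟩
      rw [mem_insert]
      exact (hx u hu v hv huv).symm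
    · refine ⟨S, Subset.rfl, hSU, fun u hu v hv huv => ?_, Or.inl rfl⟩
      rcases hx u hu v hv huv with h' | rfl
      · exact h'
      · by_contra hn
        exact h ⟨hv, hn, u, hu, huv⟩
  have hBx : ∀ v ∈ B, v ≠ x → v ∈ S := fun v hv hvx => by
    rcases hB' with rfl | ⟨-, rfl, -⟩
    · exact hv
    · exact (mem_insert.1 hv).resolve_left hvx
  have hsub : ∀ T ⊆ B, x ∉ T → T ⊆ S := fun T hT hxT v hv =>
    hBx v (hT hv) fun h => hxT (h ▸ hv)
  refine ⟨S, B, hne, hBU, ?_, fun y => ?_, hB, hB'.imp_right fun h => ⟨x, h.1, h.2.1⟩⟩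
  · have key : ∀ T ⊆ B, T.Nonempty → (B \ T).Nonempty → x ∉ T →
        (∀ u ∈ T, ∀ v ∈ B \ T, ¬ G.Adj u v) → False := by
      intro T hT hTne hTne' hxT hsep
      have hTS : T = S := hmin' T (hsub T hT hxT) hTne x fun u hu v hv huv => by
        by_contra! hcon
        exact hsep u hu v (mem_sdiff.2 ⟨hB u (hsub T hT hxT hu) v hv huv, hcon.1⟩) huv
      subst hTS
      rcases hB' with rfl | ⟨h1, rfl, u, hu, hux⟩
      · simp at hTne'
      · exact hsep u hu x (by simp [h1]) hux
    intro W hW hWne hWne'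
    by_contra! hsep
    by_cases hxW : x ∈ W
    · refine key (B \ W) sdiff_subset hWne' (by rwa [Finset.sdiff_sdiff_eq_self hW])
        (by simp [hxW]) fun u hu v hv huv => ?_
      rw [Finset.sdiff_sdiff_eq_self hW] at hv
      exact hsep v hv u hu huv.symm
    · exact key W hW hWne hWne' hxW hsep
  · have key : ∀ T ⊆ B.erase y, T.Nonempty → (B.erase y \ T).Nonempty → x ∉ T →
        (∀ u ∈ T, ∀ v ∈ B.erase y \ T, ¬ G.Adj u v) → False := by
      intro T hT hTne hTne' hxT hsep
      have hTB := hT.trans (erase_subset _ _)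
      have hTS : T = S := hmin' T (hsub T hTB hxT) hTne y fun u hu v hv huv => by
        by_contra! hcon
        exact hsep u hu v (mem_sdiff.2
          ⟨mem_erase.2 ⟨hcon.2, hB u (hsub T hTB hxT hu) v hv huv⟩, hcon.1⟩) huv
      subst hTS
      obtain ⟨w, hw⟩ := hTne'
      rw [mem_sdiff, mem_erase] at hw
      rcases hB' with rfl | ⟨h1, rfl, u, hu, hux⟩
      · exact hw.2 hw.1.2
      · obtain rfl := (mem_insert.1 hw.1.2).resolve_right hw.2
        exact hsep u hu w (mem_sdiff.2 ⟨mem_erase.2 hw.1, hw.2⟩) hux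
    intro W hW hWne hWne'
    by_contra! hsep
    by_cases hxW : x ∈ W
    · refine key (B.erase y \ W) sdiff_subset hWne' (by rwa [Finset.sdiff_sdiff_eq_self hW])
        (by simp [hxW]) fun u hu v hv huv => ?_
      rw [Finset.sdiff_sdiff_eq_self hW] at hv
      exact hsep v hv u hu huv.symm
    · exact key W hW hWne hWne' hxW hsep

/-- Gallai's bound on the number of edges of a graph whose blocks are regular of degree at most
`p`, and whose vertices have degree at most `p + 1`. -/
lemma sum_degIn_le_of_regular_blocks {p : ℕ} {D : Finset V} (hD : ∀ v ∈ D, G.degIn D v ≤ p + 1)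
    (hreg : ∀ B ⊆ D, B.Nonempty → G.ConnOn B → (∀ y, G.ConnOn (B.erase y)) →
      ∃ r ≤ p, ∀ v ∈ B, G.degIn B v = r) (U : Finset V) (hU : U ⊆ D) :
    (p + 1) * ∑ v ∈ U, G.degIn U v ≤ (p * (p + 1) + 2) * #U := by
  induction U using Finset.strongInduction with
  | H U ih =>
    rcases U.eq_empty_or_nonempty with rfl | hne
    · simp
    obtain ⟨S, B, hS, hBU, hB, hB', hSB, hcases⟩ := exists_end_block (G := G) hne
    have hsub : S ⊆ B := by
      rcases hcases with rfl | ⟨x, -, rfl⟩ <;> simp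
    obtain ⟨r, hr, hBr⟩ := hreg B (hBU.trans hU) (hS.mono hsub) hB hB'
    have hBsum : ∑ v ∈ B, G.degIn B v = #B * r := by
      rw [sum_congr rfl hBr, sum_const, smul_eq_mul]
    have hS0 : ∀ v ∈ S, G.degIn (U \ B) v = 0 := fun v hv => by
      rw [degIn, card_eq_zero, filter_eq_empty_iff]
      intro u hu huv
      rw [mem_sdiff] at hu
      exact hu.2 (hSB v hv u hu.1 huv)
    have hrem : ∀ R ⊆ U, R.Nonempty → #(U \ R) + #R = #U ∧
        (p + 1) * ∑ v ∈ U \ R, G.degIn (U \ R) v ≤ (p * (p + 1) + 2) * #(U \ R) :=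
      fun R hR hRne => ⟨card_sdiff_add_card_eq_card hR, ih _ (sdiff_ssubset hR hRne)
        (sdiff_subset.trans hU)⟩
    rcases hcases with rfl | ⟨x, hxS, rfl⟩
    · obtain ⟨h1, h2⟩ := hrem B hBU hS
      rw [sum_degIn_self hBU, hBsum, sum_eq_zero hS0, ← h1]
      have := Nat.mul_le_mul_left ((p + 1) * #B) hr
      nlinarith
    have hxB : x ∈ insert x S := mem_insert_self _ _
    have hins : ∀ v, G.degIn (insert x S) v = G.degIn {x} v + G.degIn S v := fun v => by
      rw [insert_eq, degIn_union (by simpa using hxS)]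
    have hdx : G.degIn S x = r := by
      rw [← hBr x hxB, hins, degIn_singleton]
      simp
    have hsum : ∑ v ∈ S, G.degIn {x} v = r := by
      rw [sum_degIn_comm, sum_singleton, hdx]
    have hrS : r ≤ #S := hdx ▸ card_filter_le _ _
    rcases hr.lt_or_eq with hlt | rfl
    -- For `r < p`, delete `S` and keep `x`: the degree sum drops by `#S * r + r ≤ (r + 1) * #S ≤ p
    -- * #S`.
    · have hSU := (subset_insert x S).trans hBU
      obtain ⟨h1, h2⟩ := hrem S hSU hS
      have hout : ∑ v ∈ S, G.degIn (U \ S) v = r := by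
        rw [← hsum]
        refine sum_congr rfl fun v hv => ?_
        have hx' : ({x} : Finset V) ⊆ U \ S := by
          simpa using ⟨hBU hxB, hxS⟩
        rw [degIn_sdiff hx', sdiff_sdiff_left, sup_eq_union, union_comm, ← insert_eq, hS0 v hv,
          add_zero]
      have hin : ∑ v ∈ S, G.degIn S v + r = #S * r := by
        conv_lhs => rw [← hsum]
        rw [← sum_add_distrib, ← smul_eq_mul, ← sum_const]
        refine sum_congr rfl fun v hv => ?_
        rw [← hBr v (mem_insert_of_mem hv), hins, add_comm]
      rw [sum_degIn_self hSU, hout, ← h1]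
      have h3 : (r + 1) * #S ≤ p * #S := Nat.mul_le_mul_right _ hlt
      have h4 : ∑ v ∈ S, G.degIn S v + 2 * r ≤ p * #S := by nlinarith
      have h5 := Nat.mul_le_mul_left (p + 1) h4
      nlinarith
    -- For `r = p`, delete the whole block. The degree cap at `x` leaves at most one outgoing edge,
    -- whose cost `2` is spread over at least `p + 1` vertices.
    · obtain ⟨h1, h2⟩ := hrem _ hBU (hS.mono hsub)
      have hout : ∑ v ∈ insert x S, G.degIn (U \ insert x S) v ≤ 1 := by
        rw [sum_insert hxS, sum_eq_zero hS0, add_zero]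
        have h3 := hD x (hU (hBU hxB))
        have h4 := degIn_mono (G := G) hU x
        rw [degIn_sdiff hBU, hBr x hxB] at h4
        omega
      rw [sum_degIn_self hBU, hBsum, ← h1]
      rw [card_insert_of_notMem hxS] at *
      have h5 := Nat.mul_le_mul_left (r + 1) hout
      nlinarith

end Counting

/-! ### Consequences of criticality and discharging -/

section Critical

/-- Trimming lists to size `k - 1` preserves uncolorability. Criticality is applied to induced
subgraphs only. -/
lemma exists_bad_listCover_of_isDPCritical {V : Type u} [Fintype V] {G : SimpleGraph V} {k : ℕ}
    (hk : 2 ≤ k) (hG : G.IsDPCritical k) :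
    ∃ (C : Type u) (L : V → Finset C) (H : SimpleGraph C), G.IsListCover L H ∧
      (∀ v, #(L v) = k - 1) ∧ (¬ ∃ f, ColorsOn L H univ f) ∧
      ∀ U : Finset V, U ≠ univ → ∃ f, ColorsOn L H U f := by
  classical
  obtain ⟨hchi, hcrit⟩ := hG
  have hnot : ¬ G.DPColorable (k - 1) := by
    intro h
    have h1 : G.dpChromaticNumber ≤ ((k - 1 : ℕ) : ℕ∞) := iInf₂_le (k - 1) h
    rw [hchi, Nat.cast_le] at h1
    omega
  unfold DPColorable at hnot
  push Not at hnot
  obtain ⟨C, K, hK, hbad⟩ := hnot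
  have hsub : ∀ v, ∃ t : Finset C, (t : Set C) ⊆ K.L v ∧ #t = k - 1 := by
    intro v
    obtain ⟨t, ht, htc⟩ := Set.exists_subset_encard_eq (hK v)
    have hfin : t.Finite := Set.finite_of_encard_eq_coe htc
    refine ⟨hfin.toFinset, by simpa using ht, ?_⟩
    rw [hfin.encard_eq_coe_toFinset_card, Nat.cast_inj] at htc
    exact htc
  choose L hLK hLc using hsub
  have hdisj : ∀ u v c, c ∈ L u → c ∈ L v → u = v := by
    intro u v c hu hv
    by_contra hne
    exact Set.disjoint_left.1 (K.disjoint u v hne) (hLK u hu) (hLK v hv)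
  refine ⟨C, L, K.H, ⟨fun u v huv a ha b hb b' hb' h h' => ?_, fun u v hne huv a ha b hb =>
    K.not_adj u v hne huv a (hLK u ha) b (hLK v hb)⟩, hLc, ?_, fun U hU => ?_⟩
  · exact K.matching u v huv a (hLK u ha) ⟨h, hLK v hb⟩ ⟨h', hLK v hb'⟩
  · rintro ⟨f, hf⟩
    have hinj : Function.Injective f := fun u v huv =>
      hdisj u v (f u) (hf.1 u (mem_univ _)) (huv ▸ hf.1 v (mem_univ _))
    refine hbad (Set.range f) ⟨?_, ?_⟩
    · rintro _ ⟨u, rfl⟩ _ ⟨v, rfl⟩ -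
      exact hf.2 u (mem_univ _) v (mem_univ _)
    · rw [← Set.image_univ, hinj.encard_image, Set.encard_univ]
  · obtain ⟨v₀, hv₀⟩ : ∃ v, v ∉ U := by
      by_contra! h
      exact hU (eq_univ_iff_forall.2 h)
    have : Nonempty C := ⟨(card_pos.1 (by rw [hLc]; omega : 0 < #(L v₀))).choose⟩
    have hlt := hcrit ((⊤ : G.Subgraph).induce (U : Set V)) (by
      intro h
      have h1 := congrArg Subgraph.verts h
      rw [Subgraph.induce_verts, Subgraph.verts_top] at h1
      exact hv₀ (mem_coe.1 (h1.symm ▸ Set.mem_univ v₀)))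
    obtain ⟨j, hj⟩ := iInf_lt_iff.1 hlt
    obtain ⟨hjc, hjk⟩ := iInf_lt_iff.1 hj
    rw [Nat.cast_lt] at hjk
    let C' : Type u := {c : C // ∃ v ∈ U, c ∈ L v}
    let K' : ((⊤ : G.Subgraph).induce (U : Set V)).coe.DPCover C' :=
      { L := fun v => {c | c.1 ∈ L v.1}
        H := K.H.comap Subtype.val
        disjoint := fun u v hne => Set.disjoint_left.2 fun c hu hv =>
          hne (Subtype.ext (hdisj _ _ _ hu hv))
        iUnion_eq := by
          refine Set.eq_univ_of_forall fun c => ?_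
          obtain ⟨v, hv, hc⟩ := c.2
          exact Set.mem_iUnion.2 ⟨⟨v, hv⟩, hc⟩
        isClique := fun v a ha b hb hab =>
          K.isClique v.1 (hLK _ ha) (hLK _ hb) fun h => hab (Subtype.ext h)
        matching := fun u v huv a ha b hb b' hb' => Subtype.ext
          (K.matching u.1 v.1 (by simpa using (Subgraph.coe_adj_sub _ _ _ huv)) a.1 (hLK _ ha)
            ⟨hb.1, hLK _ hb.2⟩ ⟨hb'.1, hLK _ hb'.2⟩)
        not_adj := fun u v hne huv a ha b hb =>
          K.not_adj u.1 v.1 (fun h => hne (Subtype.ext h))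
            (fun h => huv (by
              rw [Subgraph.coe_adj, Subgraph.induce_adj]
              exact ⟨u.2, v.2, by simpa using h⟩)) a.1 (hLK _ ha) b.1 (hLK _ hb) }
    obtain ⟨I, hI, hIc⟩ := hjc C' K' fun v => by
      have h1 : Subtype.val '' (K'.L v) = (L v.1 : Set C) := by
        ext c
        constructor
        · rintro ⟨c, hc, rfl⟩
          exact hc
        · exact fun hc => ⟨⟨c, v.1, v.2, hc⟩, hc, rfl⟩
      rw [← Subtype.val_injective.encard_image, h1, Set.encard_coe_eq_coe_finsetCard, hLc,
        Nat.cast_le]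
      omega
    have hown : ∀ c : C', ∃ v : ((⊤ : G.Subgraph).induce (U : Set V)).verts, c ∈ K'.L v := by
      intro c
      have := K'.iUnion_eq ▸ Set.mem_univ c
      exact Set.mem_iUnion.1 this
    choose o ho using hown
    have hoinj : Set.InjOn o I := by
      intro a ha b hb hab
      by_contra hne
      exact hI ha hb hne (K'.isClique (o a) (ho a) (hab ▸ ho b) hne)
    have hfin : (Set.univ : Set ((⊤ : G.Subgraph).induce (U : Set V)).verts).Finite :=
      Set.toFinite _
    -- Lists are cliques, so `I` has at most one color per list; by its size it meets every list.
    have himg : o '' I = Set.univ := (hfin.subset (Set.subset_univ _)).eq_of_subset_of_encard_le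
      (Set.subset_univ _) (by rw [hoinj.encard_image, hIc, Set.encard_univ])
    have hex : ∀ v ∈ U, ∃ c : C, ∃ h : ∃ v ∈ U, c ∈ L v, (⟨c, h⟩ : C') ∈ I ∧ c ∈ L v := by
      intro v hv
      obtain ⟨c, hc, hcv⟩ : (⟨v, hv⟩ : ((⊤ : G.Subgraph).induce (U : Set V)).verts) ∈ o '' I :=
        himg ▸ Set.mem_univ _
      have h1 := ho c
      rw [hcv] at h1
      exact ⟨c.1, c.2, hc, h1⟩
    choose! f h hfI hfL using hex
    refine ⟨f, hfL, fun u hu v hv huv => ?_⟩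
    exact hI (hfI u hu) (hfI v hv) (fun he => huv.ne (congrArg Subtype.val he)) huv

variable {V C : Type*} [Fintype V] {G : SimpleGraph V} [DecidableRel G.Adj]
  {L : V → Finset C} {H : SimpleGraph C} {k : ℕ}

lemma degIn_univ (v : V) : G.degIn univ v = G.degree v := by
  rw [degIn, ← card_neighborFinset_eq_degree, neighborFinset_eq_filter]

variable [DecidableEq V]

lemma degIn_add_degIn_compl (U : Finset V) (v : V) :
    G.degIn U v + G.degIn Uᶜ v = G.degree v := by
  rw [← degIn_univ, degIn_sdiff (subset_univ U), compl_eq_univ_sdiff]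

/-- A vertex of smaller degree could be colored last. -/
lemma le_degree_of_critical (hL : G.IsListCover L H) (hc : ∀ v, #(L v) = k - 1)
    (hbad : ¬ ∃ f, ColorsOn L H univ f) (hcol : ∀ U : Finset V, U ≠ univ → ∃ f, ColorsOn L H U f)
    (v : V) : k - 1 ≤ G.degree v := by
  by_contra! hlt
  obtain ⟨f, hf⟩ := hcol {v}ᶜ (by simp)
  have h1 := hL.card_le_residual hf.1 (v := v) (by simp)
  have h2 := degIn_add_degIn_compl (G := G) {v} v
  rw [hc] at h1
  obtain ⟨c, hcv⟩ : (residual L H {v}ᶜ f v).Nonempty := card_pos.1 (by omega)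
  have := hf.union (U := {v}) disjoint_compl_left (g := fun _ => c) ⟨by simpa using hcv, by simp⟩
  exact hbad ⟨_, this.mono fun w _ => by simp⟩

lemma regular_of_critical (hk : 4 ≤ k) (hL : G.IsListCover L H) (hc : ∀ v, #(L v) = k - 1)
    (hbad : ¬ ∃ f, ColorsOn L H univ f) (hcol : ∀ U : Finset V, U ≠ univ → ∃ f, ColorsOn L H U f)
    (hne : ¬ (Fintype.card V = k ∧ ∀ a b, a ≠ b → G.Adj a b)) {B : Finset V}
    (hlow : ∀ v ∈ B, G.degree v = k - 1) (hBne : B.Nonempty) (hB : G.ConnOn B)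
    (hB' : ∀ y, G.ConnOn (B.erase y)) :
    ∃ r ≤ k - 2, ∀ v ∈ B, G.degIn B v = r := by
  obtain ⟨x, hx⟩ := hBne
  obtain ⟨f, hf⟩ := hcol Bᶜ (by simpa using ne_empty_of_mem hx)
  have hdeg : ∀ v ∈ B, G.degIn B v ≤ #(residual L H Bᶜ f v) := fun v hv => by
    have h1 := hL.card_le_residual hf.1 (v := v) (by simpa using hv)
    have h2 := degIn_add_degIn_compl (G := G) B v
    rw [hc] at h1
    rw [hlow v hv] at h2
    omega
  have hbadB : ¬ ∃ g, ColorsOn (residual L H Bᶜ f) H B g := by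
    rintro ⟨g, hg⟩
    have := hf.union disjoint_compl_left hg
    exact hbad ⟨_, this.mono fun w _ => by simp [em']⟩
  have hreg : ∀ v ∈ B, G.degIn B v = G.degIn B x := fun v hv =>
    degIn_eq_of_bad (hL.mono (residual_subset _ _)) hB hB' hdeg hbadB hx hv
  refine ⟨_, ?_, hreg⟩
  by_contra! hlt
  have hout : ∀ v ∈ B, ∀ u ∉ B, ¬ G.Adj v u := by
    intro v hv u hu huv
    have h1 := degIn_lt (subset_univ B) (mem_univ u) hu huv
    rw [degIn_univ, hlow v hv, hreg v hv] at h1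
    omega
  -- No edge leaves `B`, so a coloring of `B` alone would be compatible with `f`.
  have hBuniv : B = univ := by
    by_contra hBu
    obtain ⟨g, hg⟩ := hcol B hBu
    refine hbadB ⟨g, fun v hv => mem_residual.2 ⟨hg.1 v hv, fun u hu huv => ?_⟩, hg.2⟩
    rw [mem_compl] at hu
    exact hL.not_adj u v (fun h => hu (h ▸ hv)) (fun h => hout v hv u hu h.symm) _
      (hf.1 u (by simpa using hu)) _ (hg.1 v hv) huv
  subst hBuniv
  have hadj : ∀ a b, a ≠ b → G.Adj a b := fun a b hab =>
    adj_of_bad (hL.mono (residual_subset _ _)) hB hB' hdeg hbadB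
      (fun v hv => by rw [degIn_univ, hlow v hv]; omega) (mem_univ a) (mem_univ b) hab
  refine hne ⟨?_, hadj⟩
  have h1 := hlow x hx
  have h2 : ({u | G.Adj x u} : Finset V) = univ.erase x := by
    ext u
    simpa using ⟨fun h => h.ne', fun h => hadj x u (Ne.symm h)⟩
  rw [← degIn_univ, degIn, h2, card_erase_of_mem hx, card_univ] at h1
  have : 0 < Fintype.card V := Fintype.card_pos_iff.2 ⟨x⟩
  omega

/-- The discharging between vertices of degree `k - 1` and the others. -/
lemma card_edges_bound {p : ℕ} (hp : 2 ≤ p) (hmin : ∀ v, p + 1 ≤ G.degree v)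
    (hlow : (p + 1) * ∑ v with G.degree v = p + 1, G.degIn {v | G.degree v = p + 1} v ≤
      (p * (p + 1) + 2) * #{v | G.degree v = p + 1}) :
    (p + 2) * (p + 3) * p * Fintype.card V ≤ ((p + 2) ^ 2 - 3) * ∑ v, G.degree v := by
  set D : Finset V := {v | G.degree v = p + 1} with hD
  have h1 : ∑ v, G.degree v = #D * (p + 1) + ∑ v ∈ Dᶜ, G.degree v := by
    rw [← sum_add_sum_compl D, sum_congr rfl (fun v hv => (mem_filter.1 hv).2), sum_const,
      smul_eq_mul]
  have h2 : #Dᶜ * (p + 2) ≤ ∑ v ∈ Dᶜ, G.degree v := by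
    rw [← smul_eq_mul]
    refine card_nsmul_le_sum _ _ _ fun v hv => ?_
    have h3 := hmin v
    have h4 : G.degree v ≠ p + 1 := by simpa [hD] using hv
    omega
  have h3 : #D * (p + 1) ≤ ∑ v ∈ D, G.degIn D v + ∑ v ∈ Dᶜ, G.degree v := by
    have h4 : ∑ v ∈ D, G.degree v = #D * (p + 1) := by
      rw [sum_congr rfl (fun v hv => (mem_filter.1 hv).2), sum_const, smul_eq_mul]
    rw [← h4]
    simp only [← degIn_add_degIn_compl (G := G) D, sum_add_distrib]
    rw [sum_degIn_comm D Dᶜ]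
    omega
  have h5 : #D + #Dᶜ = Fintype.card V := card_add_card_compl D
  have h6 : (p + 2) ^ 2 - 3 = p ^ 2 + 4 * p + 1 := by
    have : (p + 2) ^ 2 = p ^ 2 + 4 * p + 1 + 3 := by ring
    omega
  rw [h6, h1, ← h5]
  generalize ∑ v ∈ Dᶜ, G.degree v = X at *
  generalize ∑ v ∈ D, G.degIn D v = Y at *
  generalize #D = d at *
  generalize #Dᶜ = m at *
  have h7 := Nat.mul_le_mul_left (p + 1) h3
  have h8 : (p + 1) * d * (p + 1) ≤ (p * (p + 1) + 2) * d + (p + 1) * X := by nlinarith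
  -- With this weight on `h2`, what remains of the goal is `(p - 1) * d ≤ (p + 1) * X`, which is
  -- `h8`.
  have h9 := Nat.mul_le_mul_left (p * (p + 3)) h2
  zify at *
  nlinarith

end Critical

end SimpleGraph

open SimpleGraph in
theorem mainTheorem2 {V : Type u} [Fintype V] [DecidableEq V] (G : SimpleGraph V)
    [DecidableRel G.Adj] (k : ℕ) (hk : 4 ≤ k) (hG : G.IsDPCritical k)
    (hne : IsEmpty (G ≃g (⊤ : SimpleGraph (Fin k)))) :
    2 * (G.edgeFinset.card : ℝ) ≥
      ((k : ℝ) - 1 + ((k : ℝ) - 3) / ((k : ℝ) ^ 2 - 3)) * (Fintype.card V : ℝ) := by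
  obtain ⟨C, L, H, hL, hc, hbad, hcol⟩ := exists_bad_listCover_of_isDPCritical (by omega) hG
  have hK : ¬ (Fintype.card V = k ∧ ∀ a b, a ≠ b → G.Adj a b) := fun ⟨hV, hadj⟩ =>
    hne.false ⟨Fintype.equivFinOfCardEq hV, fun {a b} => by
      simpa using ⟨hadj a b, fun h => h.ne⟩⟩
  obtain ⟨p, rfl⟩ : ∃ p, k = p + 2 := ⟨k - 2, by omega⟩
  have hlow := sum_degIn_le_of_regular_blocks (G := G) (p := p)
    (D := {v | G.degree v = p + 1})
    (fun v hv => (degIn_mono (subset_univ _) v).trans (by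
      rw [degIn_univ, (mem_filter.1 hv).2]))
    (fun B hBD hBne hB hB' => regular_of_critical hk hL hc hbad hcol hK
      (fun v hv => (mem_filter.1 (hBD hv)).2) hBne hB hB') _ Subset.rfl
  have hmain := card_edges_bound (by omega) (le_degree_of_critical hL hc hbad hcol) hlow
  rw [sum_degrees_eq_twice_card_edges] at hmain
  have h3 : 3 ≤ (p + 2) ^ 2 := by nlinarith
  have hmain' : ((p : ℝ) + 2) * (p + 3) * p * Fintype.card V ≤
      (((p : ℝ) + 2) ^ 2 - 3) * (2 * #G.edgeFinset) := by
    have := (Nat.cast_le (α := ℝ)).2 hmain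
    push_cast [Nat.cast_sub h3] at this
    exact this
  push_cast
  have hpos : (0 : ℝ) < ((p : ℝ) + 2) ^ 2 - 3 := by
    have : (0 : ℝ) ≤ p := p.cast_nonneg
    nlinarith
  rw [ge_iff_le, show ((p : ℝ) + 2 - 1 + (p + 2 - 3) / ((p + 2) ^ 2 - 3)) =
    (p + 2) * (p + 3) * p / ((p + 2) ^ 2 - 3) by field_simp; ring, div_mul_eq_mul_div,
    div_le_iff₀ hpos]
  linarith
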